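/- Consider the initial value problem $s' = c^3$, $c' = -s^3$, $s(0)=0$, $c(0)=1$ for holomorphic functions of a complex variable; it has a solution pair in the disc $|z|<2^2/3^3$. Let $\wp$ be the (lemniscatic) Weierstrass elliptic function with invariants $g_2 = 1$ and $g_3 = 0$ (a period lattice with these invariants exists). If $(s,c)$ is a solution pair in a connected open set $U\subseteq\mathbb{C}$ containing $0$ (for instance in that disc), then the square $S = s^2$ is given on $U$ by $$S = \frac{\wp}{\wp^2 + 1/4}.$$ That is, $\wp(z)^2+\tfrac14\neq 0$ and $s(z)^2 = \wp(z)/(\wp(z)^2+\tfrac14)$ for every $z\in U$ that is not a pole of $\wp$, and $s(z)^2=0$ (the value of the right-hand side at its removable singularity) for every $z \in U$ that is a pole of $\wp$. In particular $S$ extends from $U$ to the elliptic function $\wp/(\wp^2+1/4)$, which is meromorphic on $\mathbb{C}$ and has all the periods of $\wp$. -/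

import Mathlib

/-- `s` and `c` solve, on the set `U` of complex numbers, the initial value problem
`s' = c ^ 3`, `c' = -s ^ 3`, `s 0 = 0`, `c 0 = 1` (complex derivatives). -/
structure IsIVPSolutionOn (s c : ℂ → ℂ) (U : Set ℂ) : Prop where
  hasDerivAt_s : ∀ z ∈ U, HasDerivAt s (c z ^ 3) z
  hasDerivAt_c : ∀ z ∈ U, HasDerivAt c (-(s z ^ 3)) z
  s_zero : s 0 = 0
  c_zero : c 0 = 1

/-!
The functions `S = s ^ 2`, `C = c ^ 2`, `W = s * c` satisfy the quadratic system `S' = 2CW`,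
`C' = -2SW`, `W' = C² - S²` with initial value `(0, 1, 0)`. By `℘'² = 4℘³ - ℘` and
`℘'' = 6℘² - 1/2` the elliptic functions `℘ / (℘² + 1/4)`, `(℘² - 1/4) / (℘² + 1/4)`,
`-℘' / (2 (℘² + 1/4))` satisfy the same system away from their singularities, and they tend to
`(0, 1, 0)` at the origin because `℘` has a double pole there. Two solutions with the same
limit agree near the point, since the derivative of their difference `f` is `O(f)`, whereas
differentiation lowers the order of a zero. The identity principle carries
`S = ℘ / (℘² + 1/4)` over to `U`; a zero of `℘² + 1/4` in `U` would, by `S (℘² + 1/4) = ℘`,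
also be a zero of `℘`.

The Gaussian lattice has `g₃ = 0` by its symmetry under multiplication by `I`; then `g₂ ≠ 0`, and
rescaling gives `g₂ = 1`. Solutions `s`, `c` are obtained as limits of Picard iterates.
-/

open Asymptotics Filter Metric PeriodPair Set Topology
open scoped NNReal Nat

section Picard

variable {E : Type*} [NormedAddCommGroup E] [NormedSpace ℂ E]

theorem norm_sub_le_of_norm_deriv_le_mul_pow {f f' : ℂ → E} {s : Set ℂ} {z₀ z : ℂ} {C : ℝ} {n : ℕ}
    (hs : StarConvex ℝ z₀ s) (hf : ∀ w ∈ s, HasDerivAt f (f' w) w)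
    (hf' : ∀ w ∈ s, ‖f' w‖ ≤ C * ‖w - z₀‖ ^ n) (hz : z ∈ s) :
    ‖f z - f z₀‖ ≤ C * (‖z - z₀‖ ^ (n + 1) / (n + 1)) := by
  let γ : ℝ → ℂ := fun t => z₀ + t • (z - z₀)
  have hγs : ∀ t ∈ Icc (0 : ℝ) 1, γ t ∈ s := fun t ht => hs.add_smul_sub_mem hz ht.1 ht.2
  have hγ : ∀ t, HasDerivAt γ (z - z₀) t := fun t => by
    simpa only [one_smul, id] using ((hasDerivAt_id t).smul_const (z - z₀)).const_add z₀
  have hfγ : ∀ t ∈ Icc (0 : ℝ) 1,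
      HasDerivAt (fun t => f (γ t) - f z₀) ((z - z₀) • f' (γ t)) t := fun t ht =>
    ((hf _ (hγs t ht)).scomp t (hγ t)).sub_const _
  have hB : ∀ t : ℝ, HasDerivAt (fun t : ℝ => C * ‖z - z₀‖ ^ (n + 1) * (t ^ (n + 1) / (n + 1)))
      (C * ‖z - z₀‖ ^ (n + 1) * t ^ n) t := fun t => by
    refine (((hasDerivAt_pow (n + 1) t).div_const _).const_mul _).congr_deriv ?_
    push_cast
    field_simp
  have hbound : ∀ t ∈ Ico (0 : ℝ) 1,
      ‖(z - z₀) • f' (γ t)‖ ≤ C * ‖z - z₀‖ ^ (n + 1) * t ^ n := fun t ht => by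
    have hnorm : ‖γ t - z₀‖ = t * ‖z - z₀‖ := by
      simp [γ, abs_of_nonneg ht.1]
    calc ‖(z - z₀) • f' (γ t)‖ ≤ ‖z - z₀‖ * (C * (t * ‖z - z₀‖) ^ n) := by
          rw [norm_smul, ← hnorm]
          gcongr
          exact hf' _ (hγs t (Ico_subset_Icc_self ht))
      _ = C * ‖z - z₀‖ ^ (n + 1) * t ^ n := by ring
  have h := image_norm_le_of_norm_deriv_right_le_deriv_boundary
    (fun t ht => (hfγ t ht).continuousAt.continuousWithinAt)
    (fun t ht => (hfγ t (Ico_subset_Icc_self ht)).hasDerivWithinAt) (by simp [γ]) hB hbound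
    (right_mem_Icc.2 zero_le_one)
  simpa [γ, ← div_eq_mul_inv, mul_div_assoc] using h

/-- `u` is the sequence of Picard iterates on the disc `ball z₀ r` for the initial value problem
`y' = V y`, `y z₀ = x₀`: it starts at the constant `x₀`, it takes values in `closedBall x₀ b`, and
`u (n + 1)` is the primitive of `V ∘ u n` with value `x₀` at `z₀`. -/
structure IsPicardSequence (V : E → E) (z₀ : ℂ) (x₀ : E) (r b : ℝ) (u : ℕ → ℂ → E) : Prop where
  zero : u 0 = fun _ => x₀
  apply_center : ∀ n, u n z₀ = x₀
  mapsTo : ∀ n, MapsTo (u n) (ball z₀ r) (closedBall x₀ b)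
  hasDerivAt_succ : ∀ n, ∀ z ∈ ball z₀ r, HasDerivAt (u (n + 1)) (V (u n z)) z

variable {V : E → E} {z₀ : ℂ} {x₀ : E} {r b M : ℝ} {K : ℝ≥0}

theorem exists_hasDerivAt_comp_mapsTo_closedBall [CompleteSpace E] {u : ℂ → E}
    (hV : DifferentiableOn ℂ V (closedBall x₀ b)) (hM : ∀ x ∈ closedBall x₀ b, ‖V x‖ ≤ M)
    (hMr : M * r ≤ b) (hu : DifferentiableOn ℂ u (ball z₀ r))
    (hub : MapsTo u (ball z₀ r) (closedBall x₀ b)) :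
    ∃ v : ℂ → E, v z₀ = x₀ ∧ MapsTo v (ball z₀ r) (closedBall x₀ b) ∧
      ∀ z ∈ ball z₀ r, HasDerivAt v (V (u z)) z := by
  obtain ⟨v, hv₀, hv⟩ := (hV.comp hu hub).isExactOn_ball.with_val_at z₀ x₀
  refine ⟨v, hv₀, fun z hz => ?_, hv⟩
  have hstar := (convex_ball z₀ r).starConvex (mem_ball_self (pos_of_mem_ball hz))
  have hM₀ : 0 ≤ M := (norm_nonneg _).trans (hM _ (hub hz))
  rw [mem_closedBall_iff_norm, ← hv₀]
  calc ‖v z - v z₀‖ ≤ M * ‖z - z₀‖ := by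
        simpa using norm_sub_le_of_norm_deriv_le_mul_pow (n := 0) hstar hv
          (fun w hw => by simpa using hM _ (hub hw)) hz
    _ ≤ M * r := mul_le_mul_of_nonneg_left (mem_ball_iff_norm.1 hz).le hM₀
    _ ≤ b := hMr

theorem exists_isPicardSequence [CompleteSpace E] (hb : 0 ≤ b)
    (hV : DifferentiableOn ℂ V (closedBall x₀ b)) (hM : ∀ x ∈ closedBall x₀ b, ‖V x‖ ≤ M)
    (hMr : M * r ≤ b) : ∃ u, IsPicardSequence V z₀ x₀ r b u := by
  choose! T hT₀ hTb hT using fun u : ℂ → E =>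
    exists_hasDerivAt_comp_mapsTo_closedBall (z₀ := z₀) (u := u) hV hM hMr
  have hmem : ∀ n, DifferentiableOn ℂ (T^[n] fun _ => x₀) (ball z₀ r) ∧
      MapsTo (T^[n] fun _ => x₀) (ball z₀ r) (closedBall x₀ b) := by
    intro n
    induction n with
    | zero => exact ⟨differentiableOn_const x₀, fun _ _ => mem_closedBall_self hb⟩
    | succ n ih =>
      rw [Function.iterate_succ_apply']
      exact ⟨fun z hz => (hT _ ih.1 ih.2 z hz).differentiableAt.differentiableWithinAt,
        hTb _ ih.1 ih.2⟩
  refine ⟨fun n => T^[n] fun _ => x₀, rfl, fun n => ?_, fun n => (hmem n).2, fun n => ?_⟩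
  · cases n with
    | zero => rfl
    | succ n =>
      rw [Function.iterate_succ_apply']
      exact hT₀ _ (hmem n).1 (hmem n).2
  · rw [Function.iterate_succ_apply']
    exact hT _ (hmem n).1 (hmem n).2

namespace IsPicardSequence

variable {u : ℕ → ℂ → E}

theorem differentiableOn (hu : IsPicardSequence V z₀ x₀ r b u) (n : ℕ) :
    DifferentiableOn ℂ (u n) (ball z₀ r) := by
  cases n with
  | zero => simpa only [hu.zero] using differentiableOn_const x₀
  | succ n =>
    exact fun z hz => (hu.hasDerivAt_succ n z hz).differentiableAt.differentiableWithinAt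

theorem norm_succ_sub_le (hu : IsPicardSequence V z₀ x₀ r b u)
    (hK : LipschitzOnWith K V (closedBall x₀ b)) (n : ℕ) :
    ∀ z ∈ ball z₀ r, ‖u (n + 1) z - u n z‖ ≤ b * K ^ n / n ! * ‖z - z₀‖ ^ n := by
  induction n with
  | zero =>
    intro z hz
    simpa [hu.zero, dist_eq_norm] using hu.mapsTo 1 hz
  | succ n ih =>
    intro z hz
    have hstar := (convex_ball z₀ r).starConvex (mem_ball_self (pos_of_mem_ball hz))
    have hderiv : ∀ w ∈ ball z₀ r,
        ‖V (u (n + 1) w) - V (u n w)‖ ≤ K * (b * K ^ n / n !) * ‖w - z₀‖ ^ n := fun w hw =>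
      calc ‖V (u (n + 1) w) - V (u n w)‖ ≤ K * ‖u (n + 1) w - u n w‖ :=
            hK.norm_sub_le (hu.mapsTo _ hw) (hu.mapsTo _ hw)
        _ ≤ K * (b * K ^ n / n ! * ‖w - z₀‖ ^ n) := by gcongr; exact ih w hw
        _ = K * (b * K ^ n / n !) * ‖w - z₀‖ ^ n := by ring
    have h := norm_sub_le_of_norm_deriv_le_mul_pow hstar
      (f := fun w => u (n + 2) w - u (n + 1) w)
      (fun w hw => (hu.hasDerivAt_succ (n + 1) w hw).sub (hu.hasDerivAt_succ n w hw)) hderiv hz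
    simp only [hu.apply_center, sub_self, sub_zero] at h
    refine h.trans_eq ?_
    rw [Nat.factorial_succ]
    push_cast
    field_simp
    ring

theorem exists_tendstoUniformlyOn [CompleteSpace E] (hu : IsPicardSequence V z₀ x₀ r b u)
    (hK : LipschitzOnWith K V (closedBall x₀ b)) :
    ∃ v, TendstoUniformlyOn u v atTop (ball z₀ r) := by
  have hsummable : Summable fun n : ℕ => b * ((K * r) ^ n / n !) :=
    (Real.summable_pow_div_factorial (K * r)).mul_left b
  have hbound : ∀ n, ∀ z ∈ ball z₀ r, ‖u (n + 1) z - u n z‖ ≤ b * ((K * r) ^ n / n !) := by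
    intro n z hz
    have hb : 0 ≤ b := dist_nonneg.trans (hu.mapsTo 0 hz)
    calc ‖u (n + 1) z - u n z‖ ≤ b * K ^ n / n ! * ‖z - z₀‖ ^ n := hu.norm_succ_sub_le hK n z hz
      _ ≤ b * K ^ n / n ! * r ^ n := by gcongr; exact (mem_ball_iff_norm.1 hz).le
      _ = b * ((K * r) ^ n / n !) := by ring
  have htsum := tendstoUniformlyOn_tsum_nat hsummable hbound
  have hsum : ∀ N z, ∑ n ∈ Finset.range N, (u (n + 1) z - u n z) = u N z - x₀ := fun N z => by
    rw [Finset.sum_range_sub (fun n => u n z), hu.zero]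
  simp only [hsum] at htsum
  refine ⟨fun z => (∑' n, (u (n + 1) z - u n z)) + x₀, ?_⟩
  rw [Metric.tendstoUniformlyOn_iff] at htsum ⊢
  simpa only [← dist_add_right _ (_ - x₀) x₀, sub_add_cancel] using htsum

theorem hasDerivAt_of_tendstoUniformlyOn [CompleteSpace E]
    (hu : IsPicardSequence V z₀ x₀ r b u) (hV : ContinuousOn V (closedBall x₀ b)) {v : ℂ → E}
    (hv : TendstoUniformlyOn u v atTop (ball z₀ r)) :
    ∀ z ∈ ball z₀ r, HasDerivAt v (V (v z)) z := by
  intro z hz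
  have hloc := hv.tendstoLocallyUniformlyOn
  have hdiff : ∀ᶠ n in atTop, DifferentiableOn ℂ (u n) (ball z₀ r) := .of_forall hu.differentiableOn
  have hmem : ∀ᶠ n in atTop, u n z ∈ closedBall x₀ b := .of_forall fun n => hu.mapsTo n hz
  have hvz : v z ∈ closedBall x₀ b := isClosed_closedBall.mem_of_tendsto (hv.tendsto_at hz) hmem
  have hderiv : Tendsto (fun n => deriv (u (n + 1)) z) atTop (𝓝 (deriv v z)) :=
    ((hloc.deriv hdiff isOpen_ball).tendsto_at hz).comp (tendsto_add_atTop_nat 1)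
  have hfield : Tendsto (fun n => V (u n z)) atTop (𝓝 (V (v z))) :=
    (hV _ hvz).tendsto.comp (tendsto_nhdsWithin_iff.2 ⟨hv.tendsto_at hz, hmem⟩)
  have heq : deriv v z = V (v z) :=
    tendsto_nhds_unique (hderiv.congr fun n => (hu.hasDerivAt_succ n z hz).deriv) hfield
  rw [← heq]
  exact ((hloc.differentiableOn hdiff isOpen_ball).differentiableAt
    (isOpen_ball.mem_nhds hz)).hasDerivAt

end IsPicardSequence

theorem exists_eq_forall_mem_ball_hasDerivAt [CompleteSpace E] (hb : 0 ≤ b) (hr : 0 < r)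
    (hV : DifferentiableOn ℂ V (closedBall x₀ b)) (hM : ∀ x ∈ closedBall x₀ b, ‖V x‖ ≤ M)
    (hK : LipschitzOnWith K V (closedBall x₀ b)) (hMr : M * r ≤ b) :
    ∃ u : ℂ → E, u z₀ = x₀ ∧ ∀ z ∈ ball z₀ r, HasDerivAt u (V (u z)) z := by
  obtain ⟨u, hu⟩ := exists_isPicardSequence hb hV hM hMr
  obtain ⟨v, hv⟩ := hu.exists_tendstoUniformlyOn hK
  refine ⟨v, ?_, hu.hasDerivAt_of_tendstoUniformlyOn hV.continuousOn hv⟩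
  have hlim := hv.tendsto_at (mem_ball_self hr)
  simp only [hu.apply_center] at hlim
  exact tendsto_nhds_unique hlim tendsto_const_nhds

end Picard

section Meromorphic

variable {𝕜 : Type*} [NontriviallyNormedField 𝕜]
  {E : Type*} [NormedAddCommGroup E] [NormedSpace 𝕜 E]

theorem eventuallyEq_zero_of_deriv_isBigO [CharZero 𝕜] [CompleteSpace E] {f : 𝕜 → E} {x : 𝕜}
    (hf : MeromorphicAt f x) (hf₀ : Tendsto f (𝓝[≠] x) (𝓝 0))
    (hderiv : deriv f =O[𝓝[≠] x] f) : f =ᶠ[𝓝[≠] x] 0 := by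
  refine meromorphicOrderAt_eq_top_iff.1 (by_contra fun htop => ?_)
  obtain ⟨n, hn⟩ := WithTop.ne_top_iff_exists.1 htop
  have hpos : 0 < n := by
    simpa [← hn] using (tendsto_zero_iff_meromorphicOrderAt_pos hf).1 hf₀
  have hderiv_ord : meromorphicOrderAt (deriv f) x = (n - 1 : ℤ) :=
    meromorphicOrderAt_deriv_eq_sub_one (Int.cast_ne_zero.2 hpos.ne') hn.symm
  -- Multiplication by `q` makes `f` bounded near `x` but leaves `deriv f` with a pole.
  let q : 𝕜 → 𝕜 := (· - x) ^ (-n)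
  have hq : MeromorphicAt q x := by fun_prop
  have hqf : meromorphicOrderAt (q • f) x = 0 := by
    rw [meromorphicOrderAt_smul hq hf, meromorphicOrderAt_zpow_id_sub_const, ← hn]
    norm_cast
    simp
  have hqf' : meromorphicOrderAt (q • deriv f) x < 0 := by
    rw [meromorphicOrderAt_smul hq hf.deriv, meromorphicOrderAt_zpow_id_sub_const, hderiv_ord]
    norm_cast
    simp
  obtain ⟨c, -, hc⟩ := tendsto_ne_zero_of_meromorphicOrderAt_eq_zero (hq.smul hf) hqf
  have hbdd : (q • deriv f) =O[𝓝[≠] x] fun _ => (1 : ℝ) :=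
    ((isBigO_refl q _).smul hderiv).trans (hc.isBigO_one ℝ)
  exact not_isBoundedUnder_of_tendsto_atTop
    (tendsto_norm_atTop_iff_cobounded.2 (tendsto_cobounded_of_meromorphicOrderAt_neg hqf'))
    hbdd.isBoundedUnder_le

theorem eventuallyEq_nhdsNE_of_isPreconnected
    {f g : 𝕜 → E} {U : Set 𝕜} {x z : 𝕜} (hU : IsPreconnected U)
    (hf : MeromorphicOn f U) (hg : MeromorphicOn g U) (hx : x ∈ U)
    (hz : z ∈ U) (hfg : f =ᶠ[𝓝[≠] x] g) : f =ᶠ[𝓝[≠] z] g := by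
  rw [eventuallyEq_iff_sub] at hfg ⊢
  have htop := meromorphicOrderAt_eq_top_iff.2 hfg
  refine meromorphicOrderAt_eq_top_iff.1 (by_contra fun hne => ?_)
  exact (hf.sub hg).meromorphicOrderAt_ne_top_of_isPreconnected hU hz hx hne htop

end Meromorphic

theorem eventually_nhdsNE_ne_zero_of_meromorphic {𝕜 : Type*} [RCLike 𝕜]
    {E : Type*} [NormedAddCommGroup E] [NormedSpace 𝕜 E] {f : 𝕜 → E} {x : 𝕜} (hf : Meromorphic f)
    (hx : meromorphicOrderAt f x ≠ ⊤) (z : 𝕜) : ∀ᶠ w in 𝓝[≠] z, f w ≠ 0 :=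
  (meromorphicOrderAt_ne_top_iff_eventually_ne_zero (hf z)).1
    (hf.exists_meromorphicOrderAt_ne_top_iff_forall.1 ⟨x, hx⟩ z)

section UniquenessAtSingularity

variable {E : Type*} [NormedAddCommGroup E] [NormedSpace ℂ E] [CompleteSpace E]

theorem meromorphicAt_of_differentiableAt_nhdsNE {f : ℂ → E} {z₀ : ℂ} {a : E}
    (hf : ∀ᶠ z in 𝓝[≠] z₀, DifferentiableAt ℂ f z) (ha : Tendsto f (𝓝[≠] z₀) (𝓝 a)) :
    MeromorphicAt f z₀ := by
  have heq : Function.update f z₀ a =ᶠ[𝓝[≠] z₀] f := by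
    filter_upwards [self_mem_nhdsWithin] with z hz using Function.update_of_ne hz _ _
  have hd : ∀ᶠ z in 𝓝[≠] z₀, DifferentiableAt ℂ (Function.update f z₀ a) z := by
    filter_upwards [hf, eventually_nhdsNE_eventually_nhds_iff.2 heq] with z hz hz'
    exact hz.congr_of_eventuallyEq hz'
  refine (Complex.analyticAt_of_differentiable_on_punctured_nhds_of_continuousAt
    hd (continuousAt_update_same.2 ha)).meromorphicAt.congr heq

theorem eventuallyEq_of_hasDerivAt_of_tendsto_nhdsNE
    {V : E → E} {K : ℝ≥0} {t : Set E} {u v : ℂ → E} {z₀ : ℂ}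
    {x₀ : E} (ht : t ∈ 𝓝 x₀) (hV : LipschitzOnWith K V t)
    (hu : ∀ᶠ z in 𝓝[≠] z₀, HasDerivAt u (V (u z)) z) (hu₀ : Tendsto u (𝓝[≠] z₀) (𝓝 x₀))
    (hv : ∀ᶠ z in 𝓝[≠] z₀, HasDerivAt v (V (v z)) z) (hv₀ : Tendsto v (𝓝[≠] z₀) (𝓝 x₀)) :
    u =ᶠ[𝓝[≠] z₀] v := by
  have hderiv : ∀ᶠ z in 𝓝[≠] z₀, HasDerivAt (u - v) (V (u z) - V (v z)) z := by
    filter_upwards [hu, hv] with z hz hz' using hz.sub hz'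
  have hlim : Tendsto (u - v) (𝓝[≠] z₀) (𝓝 0) := sub_self x₀ ▸ hu₀.sub hv₀
  have hO : deriv (u - v) =O[𝓝[≠] z₀] (u - v) := by
    refine .of_bound K ?_
    filter_upwards [hderiv, hu₀ ht, hv₀ ht] with z hz hut hvt
    rw [hz.deriv]
    exact hV.norm_sub_le hut hvt
  exact eventuallyEq_iff_sub.2 (eventuallyEq_zero_of_deriv_isBigO
    (meromorphicAt_of_differentiableAt_nhdsNE (hderiv.mono fun z hz => hz.differentiableAt) hlim)
    hlim hO)

end UniquenessAtSingularity

section Weierstrass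

variable (L : PeriodPair) {z : ℂ}

theorem eventually_nhdsNE_notMem_lattice (z : ℂ) : ∀ᶠ w in 𝓝[≠] z, w ∉ L.lattice := by
  filter_upwards [nhdsWithin_le_nhds (L.compl_lattice_sdiff_singleton_mem_nhds z),
    self_mem_nhdsWithin] with w hw hwz hwL using hw ⟨hwL, hwz⟩

variable {L} in
theorem hasDerivAt_weierstrassP (hz : z ∉ L.lattice) : HasDerivAt ℘[L] (℘'[L] z) z := by
  rw [← L.deriv_weierstrassP]
  exact (L.analyticOnNhd_weierstrassP z hz).differentiableAt.hasDerivAt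

theorem meromorphicOrderAt_derivWeierstrassP (hz : z ∈ L.lattice) :
    meromorphicOrderAt ℘'[L] z = (-3 : ℤ) := by
  rw [← L.deriv_weierstrassP]
  exact meromorphicOrderAt_deriv_eq_sub_one (n := -2) (by norm_num) (L.order_weierstrassP z hz)

theorem meromorphicOrderAt_weierstrassP_sq_add_const (hz : z ∈ L.lattice) (a : ℂ) :
    meromorphicOrderAt (fun w => ℘[L] w ^ 2 + a) z = (-4 : ℤ) := by
  have hsq : meromorphicOrderAt (fun w => ℘[L] w ^ 2) z = (-4 : ℤ) := by
    rw [fun_meromorphicOrderAt_pow (L.meromorphic_weierstrassP z), L.order_weierstrassP z hz]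
    rfl
  have ha : 0 ≤ meromorphicOrderAt (fun _ => a) z := analyticAt_const.meromorphicOrderAt_nonneg
  refine (meromorphicOrderAt_add_eq_left_of_lt (by fun_prop) (lt_of_lt_of_le ?_ ha)).trans hsq
  rw [hsq]
  exact WithTop.coe_lt_coe.2 (by norm_num)

theorem eventually_nhdsNE_weierstrassP_sq_add_const_ne_zero (a z : ℂ) :
    ∀ᶠ w in 𝓝[≠] z, ℘[L] w ^ 2 + a ≠ 0 := by
  have hmer : Meromorphic fun w => ℘[L] w ^ 2 + a := fun w => by
    have := L.meromorphic_weierstrassP w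
    fun_prop
  refine eventually_nhdsNE_ne_zero_of_meromorphic hmer (x := 0) ?_ z
  rw [meromorphicOrderAt_weierstrassP_sq_add_const L L.lattice.zero_mem]
  exact WithTop.coe_ne_top

theorem eventually_nhdsNE_derivWeierstrassP_ne_zero (z : ℂ) : ∀ᶠ w in 𝓝[≠] z, ℘'[L] w ≠ 0 := by
  refine eventually_nhdsNE_ne_zero_of_meromorphic L.meromorphic_derivWeierstrassP (x := 0) ?_ z
  rw [meromorphicOrderAt_derivWeierstrassP L L.lattice.zero_mem]
  exact WithTop.coe_ne_top

variable {L} in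
theorem hasDerivAt_derivWeierstrassP (hz : z ∉ L.lattice) :
    HasDerivAt ℘'[L] (6 * ℘[L] z ^ 2 - L.g₂ / 2) z := by
  have hmul : ∀ w ∉ L.lattice,
      ℘'[L] w * deriv ℘'[L] w = ℘'[L] w * (6 * ℘[L] w ^ 2 - L.g₂ / 2) := fun w hw => by
    have hP := hasDerivAt_weierstrassP hw
    have hP' := (L.analyticOnNhd_derivWeierstrassP w hw).differentiableAt.hasDerivAt
    have hcubic := ((hP.fun_pow 3).const_mul 4).sub (hP.const_mul L.g₂) |>.sub_const L.g₃
    have hsq : (fun w => ℘'[L] w ^ 2) =ᶠ[𝓝 w] fun w => 4 * ℘[L] w ^ 3 - L.g₂ * ℘[L] w - L.g₃ := by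
      filter_upwards [L.isClosed_lattice.isOpen_compl.mem_nhds hw] using L.derivWeierstrassP_sq
    have h := (hP'.fun_pow 2).unique (hcubic.congr_of_eventuallyEq hsq)
    norm_num at h
    linear_combination h / 2
  have heq : deriv ℘'[L] =ᶠ[𝓝[≠] z] fun w => 6 * ℘[L] w ^ 2 - L.g₂ / 2 := by
    filter_upwards [eventually_nhdsNE_notMem_lattice L z,
      eventually_nhdsNE_derivWeierstrassP_ne_zero L z] with w hw hw'
      using mul_left_cancel₀ hw' (hmul w hw)
  have hP := L.analyticOnNhd_weierstrassP z hz
  have hP' := L.analyticOnNhd_derivWeierstrassP z hz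
  have hrhs : AnalyticAt ℂ (fun w => 6 * ℘[L] w ^ 2 - L.g₂ / 2) z := by fun_prop
  refine hP'.differentiableAt.hasDerivAt.congr_deriv ?_
  exact tendsto_nhds_unique_of_eventuallyEq
    (hP'.deriv.continuousAt.tendsto.mono_left nhdsWithin_le_nhds)
    (hrhs.continuousAt.tendsto.mono_left nhdsWithin_le_nhds) heq

theorem periodic_weierstrassP {l : ℂ} (hl : l ∈ L.lattice) : Function.Periodic ℘[L] l :=
  fun z => L.weierstrassP_add_coe z ⟨l, hl⟩

theorem meromorphic_weierstrassP_div_sq_add_const (a : ℂ) :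
    Meromorphic fun z => ℘[L] z / (℘[L] z ^ 2 + a) := fun z => by
  have hP := L.meromorphic_weierstrassP z
  fun_prop

theorem derivWeierstrassP_eq_zero_of_two_mul_mem (hz : 2 * z ∈ L.lattice) : ℘'[L] z = 0 := by
  have h := L.derivWeierstrassP_add_coe (-z) ⟨2 * z, hz⟩
  rw [L.derivWeierstrassP_neg, show -z + 2 * z = z by ring] at h
  exact CharZero.eq_neg_self_iff.1 h

theorem g₂_ne_zero_or_g₃_ne_zero : L.g₂ ≠ 0 ∨ L.g₃ ≠ 0 := by
  by_contra! ⟨h₂, h₃⟩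
  have hsq : ∀ z ∉ L.lattice, ℘'[L] z ^ 2 = 4 * ℘[L] z ^ 3 := fun z hz => by
    simpa [h₂, h₃] using L.derivWeierstrassP_sq z hz
  set w := L.ω₁ / 2 with hw
  have hwL : w ∉ L.lattice := L.ω₁_div_two_notMem_lattice
  have hPw : ℘[L] w = 0 := by
    have hP'w : ℘'[L] w = 0 := derivWeierstrassP_eq_zero_of_two_mul_mem L
      (by simpa [hw, mul_div_cancel₀] using L.ω₁_mem_lattice)
    simpa [hP'w] using (hsq w hwL).symm
  have hlim : Tendsto ℘[L] (𝓝[≠] w) (𝓝 0) :=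
    hPw ▸ (L.analyticOnNhd_weierstrassP w hwL).continuousAt.tendsto.mono_left nhdsWithin_le_nhds
  -- `℘' ^ 2 = 4 * ℘ ^ 3` gives `℘' = O(℘)` at the zero `w`, so that `℘` vanishes identically.
  have hO : ℘'[L] =O[𝓝[≠] w] ℘[L] := by
    refine IsBigO.of_pow two_ne_zero (.of_bound 4 ?_)
    filter_upwards [eventually_nhdsNE_notMem_lattice L w,
      hlim.norm.eventually_le_const (u := 1) (by simp)] with z hz hz1
    simp only [Pi.pow_apply, hsq z hz, norm_mul, norm_pow, Complex.norm_ofNat]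
    gcongr 4 * ?_
    exact pow_le_pow_of_le_one (norm_nonneg _) hz1 (by norm_num)
  have hzero : ℘[L] =ᶠ[𝓝[≠] w] 0 :=
    eventuallyEq_zero_of_deriv_isBigO (L.meromorphic_weierstrassP w) hlim
      (by rwa [L.deriv_weierstrassP])
  obtain ⟨z, hz, hz'⟩ :=
    (hzero.and (eventually_nhdsNE_weierstrassP_sq_add_const_ne_zero L 0 w)).exists
  simp [hz] at hz'

/-- The basis `(a * ω₁, a * ω₂)` of the lattice `a • L.lattice`. Rescaling multiplies the Eisenstein
series `G n` by `a⁻¹ ^ n`, which serves to normalize the invariants. -/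
noncomputable def scaledPeriodPair (a : ℂ) (ha : a ≠ 0) : PeriodPair where
  ω₁ := a * L.ω₁
  ω₂ := a * L.ω₂
  indep := by
    rw [LinearIndependent.pair_iff]
    intro s t h
    refine LinearIndependent.pair_iff.1 L.indep s t (mul_left_cancel₀ ha ?_)
    rw [mul_zero, ← h, mul_add, mul_smul_comm, mul_smul_comm]

theorem mul_mem_lattice_scaledPeriodPair {a : ℂ} (ha : a ≠ 0) {x : ℂ} :
    a * x ∈ (scaledPeriodPair L a ha).lattice ↔ x ∈ L.lattice := by
  simp only [mem_lattice, scaledPeriodPair]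
  refine exists₂_congr fun m n => ?_
  rw [← mul_right_inj' (b := m * L.ω₁ + n * L.ω₂) ha, mul_add, mul_left_comm a, mul_left_comm a]

variable {L} in
theorem G_eq_of_forall_mul_mem_lattice_iff {L' : PeriodPair} {a : ℂ} (ha : a ≠ 0)
    (h : ∀ x, a * x ∈ L'.lattice ↔ x ∈ L.lattice) (n : ℕ) : L'.G n = (a ^ n)⁻¹ * L.G n := by
  let e : L.lattice ≃ L'.lattice := (Equiv.mulLeft₀ a ha).subtypeEquiv fun x => (h x).symm
  rw [G, ← e.tsum_eq, G, ← tsum_mul_left]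
  refine tsum_congr fun l => ?_
  change ((a * (l : ℂ)) ^ n)⁻¹ = _
  rw [mul_pow, mul_inv]

/-- The basis `(1, I)` of the lattice of Gaussian integers, the square lattice up to scaling. -/
noncomputable def gaussianPeriodPair : PeriodPair where
  ω₁ := 1
  ω₂ := Complex.I
  indep := by
    rw [LinearIndependent.pair_iff]
    intro s t h
    simpa using And.intro (congrArg Complex.re h) (congrArg Complex.im h)

theorem I_mul_mem_lattice_gaussianPeriodPair (x : ℂ) :
    Complex.I * x ∈ gaussianPeriodPair.lattice ↔ x ∈ gaussianPeriodPair.lattice := by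
  have hmul : ∀ y ∈ gaussianPeriodPair.lattice, Complex.I * y ∈ gaussianPeriodPair.lattice := by
    intro y hy
    obtain ⟨m, n, rfl⟩ := mem_lattice.1 hy
    refine mem_lattice.2 ⟨-n, m, ?_⟩
    simp only [gaussianPeriodPair]
    push_cast
    linear_combination (-(n : ℂ)) * Complex.I_mul_I
  refine ⟨fun h => ?_, hmul x⟩
  have := gaussianPeriodPair.lattice.neg_mem (hmul _ h)
  rwa [← mul_assoc, Complex.I_mul_I, neg_one_mul, neg_neg] at this

theorem g₃_gaussianPeriodPair : gaussianPeriodPair.g₃ = 0 := by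
  have h := G_eq_of_forall_mul_mem_lattice_iff Complex.I_ne_zero
    I_mul_mem_lattice_gaussianPeriodPair 6
  have hI : (Complex.I ^ 6)⁻¹ = -1 := by
    norm_num [Complex.I_pow_eq_pow_mod 6]
  rw [hI, neg_one_mul, CharZero.eq_neg_self_iff] at h
  rw [g₃, h, mul_zero]

theorem exists_g₂_eq_g₃_eq_zero {c : ℂ} (hc : c ≠ 0) :
    ∃ L : PeriodPair, L.g₂ = c ∧ L.g₃ = 0 := by
  have hg : gaussianPeriodPair.g₂ ≠ 0 :=
    (g₂_ne_zero_or_g₃_ne_zero _).resolve_right (not_not.2 g₃_gaussianPeriodPair)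
  obtain ⟨a, ha⟩ := IsAlgClosed.exists_pow_nat_eq (gaussianPeriodPair.g₂ / c) (n := 4) (by norm_num)
  have ha₀ : a ≠ 0 := by
    rintro rfl
    exact div_ne_zero hg hc (by simpa using ha.symm)
  have hG := G_eq_of_forall_mul_mem_lattice_iff ha₀ fun x =>
    mul_mem_lattice_scaledPeriodPair gaussianPeriodPair ha₀ (x := x)
  refine ⟨scaledPeriodPair gaussianPeriodPair a ha₀, ?_, ?_⟩
  · rw [g₂, hG, mul_left_comm, ← g₂, ha, inv_div, div_mul_cancel₀ _ hg]
  · rw [g₃, hG, mul_left_comm, ← g₃, g₃_gaussianPeriodPair, mul_zero]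

end Weierstrass

/-- The quadratic vector field `(S, C, W) ↦ (2CW, -2SW, C² - S²)`. It is the system satisfied by
`S = s ^ 2`, `C = c ^ 2`, `W = s * c` when `s' = c ^ 3` and `c' = -s ^ 3`. -/
def squareField (x : ℂ × ℂ × ℂ) : ℂ × ℂ × ℂ :=
  (2 * x.2.1 * x.2.2, -(2 * x.1 * x.2.2), x.2.1 ^ 2 - x.1 ^ 2)

section LemniscaticCurve

variable (L : PeriodPair) {z : ℂ}

/-- The elliptic solution of `squareField`, starting at `(0, 1, 0)`. Its second component is
`(℘ ^ 2 - 1 / 4) / (℘ ^ 2 + 1 / 4)`. -/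
noncomputable def lemniscaticCurve (z : ℂ) : ℂ × ℂ × ℂ :=
  (℘[L] z / (℘[L] z ^ 2 + 1 / 4), 1 - (℘[L] z ^ 2 + 1 / 4)⁻¹ / 2,
    -(℘'[L] z / (℘[L] z ^ 2 + 1 / 4)) / 2)

variable {L} in
theorem hasDerivAt_lemniscaticCurve (h₂ : L.g₂ = 1) (h₃ : L.g₃ = 0) (hz : z ∉ L.lattice)
    (hne : ℘[L] z ^ 2 + 1 / 4 ≠ 0) :
    HasDerivAt (lemniscaticCurve L) (squareField (lemniscaticCurve L z)) z := by
  have hP := hasDerivAt_weierstrassP hz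
  have hP' := hasDerivAt_derivWeierstrassP hz
  have hsq := L.derivWeierstrassP_sq z hz
  rw [h₂] at hP'
  rw [h₂, h₃] at hsq
  have hQ : HasDerivAt (fun w => ℘[L] w ^ 2 + 1 / 4) (2 * ℘[L] z * ℘'[L] z) z := by
    simpa using (hP.fun_pow 2).add_const (1 / 4)
  refine ((hP.fun_div hQ hne).prodMk ((((hQ.fun_inv hne).div_const 2).const_sub 1).prodMk
    ((hP'.fun_div hQ hne).fun_neg.div_const 2))).congr_deriv ?_
  simp only [squareField, lemniscaticCurve, Prod.mk.injEq]
  generalize hq : ℘[L] z ^ 2 + 1 / 4 = q at hne ⊢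
  refine ⟨?_, ?_, ?_⟩
  · field_simp
    linear_combination -4 * ℘'[L] z * hq
  · field_simp
  · field_simp
    subst hq
    linear_combination 4 * ℘[L] z * hsq

theorem tendsto_lemniscaticCurve_nhdsNE (hz : z ∈ L.lattice) :
    Tendsto (lemniscaticCurve L) (𝓝[≠] z) (𝓝 (0, 1, 0)) := by
  have hP := L.meromorphic_weierstrassP z
  have hP' := L.meromorphic_derivWeierstrassP z
  have hQ := meromorphicOrderAt_weierstrassP_sq_add_const L hz (1 / 4)
  have hS : Tendsto (fun w => ℘[L] w / (℘[L] w ^ 2 + 1 / 4)) (𝓝[≠] z) (𝓝 0) := by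
    refine tendsto_zero_of_meromorphicOrderAt_pos ?_
    rw [fun_meromorphicOrderAt_div hP (by fun_prop), L.order_weierstrassP z hz, hQ]
    exact WithTop.coe_lt_coe.2 (by norm_num)
  have hC : Tendsto (fun w => (℘[L] w ^ 2 + 1 / 4)⁻¹) (𝓝[≠] z) (𝓝 0) := by
    refine tendsto_zero_of_meromorphicOrderAt_pos ?_
    rw [fun_meromorphicOrderAt_inv, hQ]
    exact WithTop.coe_lt_coe.2 (by norm_num)
  have hW : Tendsto (fun w => ℘'[L] w / (℘[L] w ^ 2 + 1 / 4)) (𝓝[≠] z) (𝓝 0) := by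
    refine tendsto_zero_of_meromorphicOrderAt_pos ?_
    rw [fun_meromorphicOrderAt_div hP' (by fun_prop), meromorphicOrderAt_derivWeierstrassP L hz, hQ]
    exact WithTop.coe_lt_coe.2 (by norm_num)
  have h := hS.prodMk_nhds (((hC.div_const 2).const_sub 1).prodMk_nhds (hW.neg.div_const 2))
  simp only [zero_div, sub_zero, neg_zero] at h
  exact h

end LemniscaticCurve

theorem exists_lipschitzOnWith_squareField (x : ℂ × ℂ × ℂ) :
    ∃ K, ∃ t ∈ 𝓝 x, LipschitzOnWith K squareField t := by
  have h : ContDiff ℂ 1 squareField := by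
    unfold squareField
    fun_prop
  exact h.contDiffAt.exists_lipschitzOnWith

theorem exists_isIVPSolutionOn_ball :
    ∃ s c : ℂ → ℂ, IsIVPSolutionOn s c (ball 0 (2 ^ 2 / 3 ^ 3)) := by
  let V : ℂ × ℂ → ℂ × ℂ := fun x => (x.2 ^ 3, -(x.1 ^ 3))
  have hV : ContDiff ℂ 1 V := by fun_prop
  have hM : ∀ x ∈ closedBall ((0, 1) : ℂ × ℂ) (1 / 2), ‖V x‖ ≤ (3 / 2) ^ 3 := fun x hx => by
    have h : ‖x‖ ≤ 3 / 2 :=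
      (norm_le_of_mem_closedBall hx).trans_eq (by norm_num [Prod.norm_def])
    simp only [V, Prod.norm_def, norm_neg, norm_pow]
    have h₁ := (norm_fst_le x).trans h
    have h₂ := (norm_snd_le x).trans h
    exact max_le (by gcongr) (by gcongr)
  obtain ⟨K, hK⟩ := (hV.restrict_scalars ℝ).contDiffOn.exists_lipschitzOnWith one_ne_zero
    (convex_closedBall ((0, 1) : ℂ × ℂ) (1 / 2)) (isCompact_closedBall _ _)
  -- On the closed ball of radius `b` the cubes are bounded by `(1 + b) ^ 3`, and `b / (1 + b) ^ 3`
  -- attains its maximum `2 ^ 2 / 3 ^ 3` at `b = 1 / 2`.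
  obtain ⟨u, hu₀, hu⟩ := exists_eq_forall_mem_ball_hasDerivAt (z₀ := 0) (r := 2 ^ 2 / 3 ^ 3)
    (by norm_num) (by norm_num) (hV.differentiable one_ne_zero).differentiableOn hM hK (by norm_num)
  exact ⟨fun z => (u z).1, fun z => (u z).2,
    { hasDerivAt_s := fun z hz =>
        (ContinuousLinearMap.fst ℂ ℂ ℂ).hasFDerivAt.comp_hasDerivAt z (hu z hz)
      hasDerivAt_c := fun z hz =>
        (ContinuousLinearMap.snd ℂ ℂ ℂ).hasFDerivAt.comp_hasDerivAt z (hu z hz)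
      s_zero := by rw [hu₀]
      c_zero := by rw [hu₀] }⟩

namespace IsIVPSolutionOn

variable {s c : ℂ → ℂ} {U : Set ℂ} {z : ℂ} {L : PeriodPair}

theorem analyticAt_s (h : IsIVPSolutionOn s c U) (hU : IsOpen U) (hz : z ∈ U) :
    AnalyticAt ℂ s z :=
  DifferentiableOn.analyticAt
    (fun w hw => (h.hasDerivAt_s w hw).differentiableAt.differentiableWithinAt) (hU.mem_nhds hz)

theorem hasDerivAt_squareField (h : IsIVPSolutionOn s c U) (hz : z ∈ U) :
    HasDerivAt (fun w => (s w ^ 2, c w ^ 2, s w * c w))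
      (squareField (s z ^ 2, c z ^ 2, s z * c z)) z := by
  have hs := h.hasDerivAt_s z hz
  have hc := h.hasDerivAt_c z hz
  refine ((hs.fun_pow 2).prodMk ((hc.fun_pow 2).prodMk (hs.fun_mul hc))).congr_deriv ?_
  simp only [squareField, Prod.mk.injEq, Nat.add_one_sub_one, Nat.cast_ofNat, pow_one]
  exact ⟨by ring, by ring, by ring⟩

theorem sq_eventuallyEq_nhdsNE_zero (h : IsIVPSolutionOn s c U) (hU : U ∈ 𝓝 0)
    (h₂ : L.g₂ = 1) (h₃ : L.g₃ = 0) :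
    (fun w => s w ^ 2) =ᶠ[𝓝[≠] 0] fun w => ℘[L] w / (℘[L] w ^ 2 + 1 / 4) := by
  obtain ⟨K, t, ht, hK⟩ := exists_lipschitzOnWith_squareField (0, 1, 0)
  have hsol : ∀ᶠ w in 𝓝[≠] 0, HasDerivAt (fun w => (s w ^ 2, c w ^ 2, s w * c w))
      (squareField (s w ^ 2, c w ^ 2, s w * c w)) w :=
    (eventually_of_mem hU fun w hw => h.hasDerivAt_squareField hw).filter_mono nhdsWithin_le_nhds
  have hsol₀ : Tendsto (fun w => (s w ^ 2, c w ^ 2, s w * c w)) (𝓝[≠] 0) (𝓝 (0, 1, 0)) := by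
    have hcont := (h.hasDerivAt_squareField (mem_of_mem_nhds hU)).continuousAt
    simpa [ContinuousAt, h.s_zero, h.c_zero] using hcont.tendsto.mono_left nhdsWithin_le_nhds
  have hcurve : ∀ᶠ w in 𝓝[≠] 0,
      HasDerivAt (lemniscaticCurve L) (squareField (lemniscaticCurve L w)) w := by
    filter_upwards [eventually_nhdsNE_notMem_lattice L 0,
      eventually_nhdsNE_weierstrassP_sq_add_const_ne_zero L (1 / 4) 0] with w hw hne
      using hasDerivAt_lemniscaticCurve h₂ h₃ hw hne
  exact (eventuallyEq_of_hasDerivAt_of_tendsto_nhdsNE ht hK hsol hsol₀ hcurve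
    (tendsto_lemniscaticCurve_nhdsNE L L.lattice.zero_mem)).fun_comp Prod.fst

theorem sq_eventuallyEq_nhdsNE (h : IsIVPSolutionOn s c U) (hU : IsOpen U)
    (hconn : IsPreconnected U) (h₀ : 0 ∈ U) (h₂ : L.g₂ = 1) (h₃ : L.g₃ = 0) (hz : z ∈ U) :
    (fun w => s w ^ 2) =ᶠ[𝓝[≠] z] fun w => ℘[L] w / (℘[L] w ^ 2 + 1 / 4) := by
  refine eventuallyEq_nhdsNE_of_isPreconnected hconn (fun w hw => ?_)
    (fun w _ => meromorphic_weierstrassP_div_sq_add_const L _ w) h₀ hz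
    (h.sq_eventuallyEq_nhdsNE_zero (hU.mem_nhds h₀) h₂ h₃)
  exact ((h.analyticAt_s hU hw).fun_pow 2).meromorphicAt

theorem sq_eq_of_notMem_lattice (h : IsIVPSolutionOn s c U) (hU : IsOpen U)
    (hconn : IsPreconnected U) (h₀ : 0 ∈ U) (h₂ : L.g₂ = 1) (h₃ : L.g₃ = 0) (hz : z ∈ U)
    (hzL : z ∉ L.lattice) :
    ℘[L] z ^ 2 + 1 / 4 ≠ 0 ∧ s z ^ 2 = ℘[L] z / (℘[L] z ^ 2 + 1 / 4) := by
  have hs := (h.analyticAt_s hU hz).continuousAt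
  have hP := (L.analyticOnNhd_weierstrassP z hzL).continuousAt
  have hlhs : ContinuousAt (fun w => s w ^ 2 * (℘[L] w ^ 2 + 1 / 4)) z := by fun_prop
  have hmul : s z ^ 2 * (℘[L] z ^ 2 + 1 / 4) = ℘[L] z := by
    refine tendsto_nhds_unique_of_eventuallyEq (l := 𝓝[≠] z)
      (hlhs.tendsto.mono_left nhdsWithin_le_nhds)
      (hP.tendsto.mono_left nhdsWithin_le_nhds) ?_
    filter_upwards [h.sq_eventuallyEq_nhdsNE hU hconn h₀ h₂ h₃ hz,
      eventually_nhdsNE_weierstrassP_sq_add_const_ne_zero L (1 / 4) z] with w hw hne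
      using (eq_div_iff hne).1 hw
  have hne : ℘[L] z ^ 2 + 1 / 4 ≠ 0 := fun hQ => by
    have hPz : ℘[L] z = 0 := by rw [← hmul, hQ, mul_zero]
    norm_num [hPz] at hQ
  exact ⟨hne, (eq_div_iff hne).2 hmul⟩

theorem sq_eq_zero_of_mem_lattice (h : IsIVPSolutionOn s c U) (hU : IsOpen U)
    (hconn : IsPreconnected U) (h₀ : 0 ∈ U) (h₂ : L.g₂ = 1) (h₃ : L.g₃ = 0) (hz : z ∈ U)
    (hzL : z ∈ L.lattice) : s z ^ 2 = 0 := by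
  have hs : Tendsto (fun w => s w ^ 2) (𝓝[≠] z) (𝓝 (s z ^ 2)) :=
    ((h.analyticAt_s hU hz).continuousAt.pow 2).tendsto.mono_left nhdsWithin_le_nhds
  exact tendsto_nhds_unique_of_eventuallyEq hs (tendsto_lemniscaticCurve_nhdsNE L hzL).fst_nhds
    (h.sq_eventuallyEq_nhdsNE hU hconn h₀ h₂ h₃ hz)

end IsIVPSolutionOn

theorem theorem7 :
    -- lattices with invariants 1 and 0 exist
    (∃ L : PeriodPair, L.g₂ = 1 ∧ L.g₃ = 0) ∧
    -- a solution of the initial value problem exists on the disc of radius 4/27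
    (∃ s c : ℂ → ℂ, IsIVPSolutionOn s c (Metric.ball 0 (2 ^ 2 / 3 ^ 3))) ∧
    ∀ L : PeriodPair, L.g₂ = 1 → L.g₃ = 0 →
      -- the right-hand side is an elliptic function
      (Meromorphic (fun z : ℂ => L.weierstrassP z / (L.weierstrassP z ^ 2 + 1 / 4)) ∧
        ∀ l ∈ L.lattice, Function.Periodic
          (fun z : ℂ => L.weierstrassP z / (L.weierstrassP z ^ 2 + 1 / 4)) l) ∧
      -- and it is the square of `s`, wherever a solution of the initial value problem is given;
      -- at the lattice points its singularity is removable, with value 0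
      ∀ (U : Set ℂ), IsOpen U → IsConnected U → (0 : ℂ) ∈ U →
        ∀ s c : ℂ → ℂ, IsIVPSolutionOn s c U →
          ∀ z ∈ U,
            (z ∉ L.lattice →
              L.weierstrassP z ^ 2 + 1 / 4 ≠ 0 ∧
              s z ^ 2 = L.weierstrassP z / (L.weierstrassP z ^ 2 + 1 / 4)) ∧
            (z ∈ L.lattice → s z ^ 2 = 0) := by
  refine ⟨exists_g₂_eq_g₃_eq_zero one_ne_zero, exists_isIVPSolutionOn_ball, fun L h₂ h₃ =>
    ⟨⟨meromorphic_weierstrassP_div_sq_add_const L _, fun l hl => ?_⟩,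
      fun U hU hconn h₀ s c h z hz => ⟨?_, ?_⟩⟩⟩
  · exact (periodic_weierstrassP L hl).comp fun x => x / (x ^ 2 + 1 / 4)
  · exact h.sq_eq_of_notMem_lattice hU hconn.isPreconnected h₀ h₂ h₃ hz
  · exact h.sq_eq_zero_of_mem_lattice hU hconn.isPreconnected h₀ h₂ h₃ hz
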